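/- Let $\Bbbk$ be a field, $N\ge 1$ an integer, $S$ a finite set and $\omega$ a permutation of $S$. Let $A=\Bbbk(\omega,N)$ be the associative unital $\Bbbk$-algebra presented by generators $x$ and $e_s$ $(s\in S)$ and relations, for all $s,t\in S$, \[ e_se_t=\delta_{s,t}e_t,\qquad 1_A=\sum_{s\in S}e_s,\qquad x^N=0,\qquad e_sx=xe_{\omega(s)}. \] Let $R$ be the subalgebra of $A$ generated by $x$, and for $s\in S$ and $0\le t\le N-1$ let $N_{s,t}=e_sx^tR=\{e_sx^tr\mid r\in R\}$, which is a right ideal of $A$. A right ideal of $A$ is called indecomposable if it is nonzero and is not the direct sum of two nonzero right $A$-submodules. Then the $N_{s,t}$ ($s\in S$, $0\le t\le N-1$) form an irredundant set of representatives of the indecomposable right ideals of $A$ up to isomorphism of right $A$-modules: each $N_{s,t}$ is indecomposable, every indecomposable right ideal of $A$ is isomorphic to some $N_{s,t}$, and $N_{s,t}\cong N_{s',t'}$ only if $(s,t)=(s',t')$. Moreover, the set of all indecomposable right ideals of $A$ is equal to \[ \{(1+rx)N_{s,t}\mid r\in R,\ s\in S,\ 0\le t\le N-1\}. \] -/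

import Mathlib

open scoped Pointwise

namespace OmegaAlgebra

universe u v

/-- The generators `e_s` (for `s ∈ S`) and `x`. -/
inductive Gen (S : Type v) : Type v
  | e (s : S) : Gen S
  | x : Gen S

/-- The defining relations of `k(ω, N)`, in the free algebra on the generators:
`e_s e_t = δ_{s,t} e_t`, `1 = ∑ s, e_s`, `x ^ N = 0` and `e_s x = x e_{ω(s)}`. -/
inductive Rel (k : Type u) [Field k] {S : Type v} [Fintype S] (ω : Equiv.Perm S) (N : ℕ) :
    FreeAlgebra k (Gen S) → FreeAlgebra k (Gen S) → Prop
  | idem (s : S) : Rel k ω N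
      (FreeAlgebra.ι k (Gen.e s) * FreeAlgebra.ι k (Gen.e s)) (FreeAlgebra.ι k (Gen.e s))
  | orth (s t : S) (h : s ≠ t) : Rel k ω N
      (FreeAlgebra.ι k (Gen.e s) * FreeAlgebra.ι k (Gen.e t)) 0
  | one : Rel k ω N 1 (∑ s : S, FreeAlgebra.ι k (Gen.e s))
  | pow : Rel k ω N (FreeAlgebra.ι k Gen.x ^ N) 0
  | comm (s : S) : Rel k ω N
      (FreeAlgebra.ι k (Gen.e s) * FreeAlgebra.ι k Gen.x)
      (FreeAlgebra.ι k Gen.x * FreeAlgebra.ι k (Gen.e (ω s)))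

/-- The `k`-algebra `k(ω, N)`: the quotient of the free algebra by the two-sided ideal generated
by the defining relations. -/
abbrev Alg (k : Type u) [Field k] {S : Type v} [Fintype S] (ω : Equiv.Perm S) (N : ℕ) :
    Type (max u v) :=
  RingQuot (Rel k ω N)

section

variable (k : Type u) [Field k] {S : Type v} [Fintype S] (ω : Equiv.Perm S) (N : ℕ)

/-- The class of the generator `e_s` in `k(ω, N)`. -/
noncomputable def e (s : S) : Alg k ω N :=
  RingQuot.mkAlgHom k (Rel k ω N) (FreeAlgebra.ι k (Gen.e s))

/-- The class of the generator `x` in `k(ω, N)`. -/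
noncomputable def x : Alg k ω N :=
  RingQuot.mkAlgHom k (Rel k ω N) (FreeAlgebra.ι k Gen.x)

/-- The subalgebra `R` of `k(ω, N)` generated by `x`. -/
noncomputable def R : Subalgebra k (Alg k ω N) :=
  Algebra.adjoin k {x k ω N}

theorem e_mul_self (s : S) : e k ω N s * e k ω N s = e k ω N s := by
  simpa [e] using RingQuot.mkAlgHom_rel k (Rel.idem (k := k) (ω := ω) (N := N) s)

theorem e_mul_of_ne {s t : S} (h : s ≠ t) : e k ω N s * e k ω N t = 0 := by
  simpa [e] using RingQuot.mkAlgHom_rel k (Rel.orth (k := k) (ω := ω) (N := N) s t h)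

theorem e_mul_x (s : S) : e k ω N s * x k ω N = x k ω N * e k ω N (ω s) := by
  simpa [e, x] using RingQuot.mkAlgHom_rel k (Rel.comm (k := k) (ω := ω) (N := N) s)

theorem x_mem_R : x k ω N ∈ R k ω N :=
  Algebra.subset_adjoin rfl

theorem e_mul_x_pow (n : ℕ) : ∀ s : S,
    e k ω N s * x k ω N ^ n = x k ω N ^ n * e k ω N ((ω ^ n) s) := by
  induction n with
  | zero => intro s; simp
  | succ n ih =>
    intro s
    rw [pow_succ', ← mul_assoc, e_mul_x, mul_assoc, ih, ← mul_assoc, pow_succ ω,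
      Equiv.Perm.mul_apply]

/-- `e_s R e_u` is contained in `e_s R`. -/
theorem e_mul_R_mul_e (s u : S) (r : Alg k ω N) (hr : r ∈ R k ω N) :
    ∃ r' ∈ R k ω N, e k ω N s * r * e k ω N u = e k ω N s * r' := by
  rw [R, Algebra.adjoin_singleton_eq_range_aeval] at hr
  obtain ⟨p, rfl⟩ := hr
  induction p using Polynomial.induction_on' with
  | add p q hp hq =>
    obtain ⟨a, ha, ha'⟩ := hp
    obtain ⟨b, hb, hb'⟩ := hq
    refine ⟨a + b, add_mem ha hb, ?_⟩
    rw [mul_add, ← ha', ← hb', ← add_mul, ← mul_add]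
    simp
  | monomial n c =>
    have h : e k ω N s * x k ω N ^ n * e k ω N u = 0 ∨
        e k ω N s * x k ω N ^ n * e k ω N u = e k ω N s * x k ω N ^ n := by
      rw [e_mul_x_pow, mul_assoc]
      by_cases hu : (ω ^ n) s = u
      · right; rw [hu, e_mul_self]
      · left; rw [e_mul_of_ne k ω N hu, mul_zero]
    rcases h with h | h
    · refine ⟨0, zero_mem _, ?_⟩
      simp [Polynomial.aeval_monomial, ← Algebra.smul_def, h]
    · refine ⟨c • x k ω N ^ n, Subalgebra.smul_mem _ (pow_mem (x_mem_R k ω N) n) c, ?_⟩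
      simp [Polynomial.aeval_monomial, ← Algebra.smul_def, h]

/-- `e_s R` is closed under right multiplication by `k(ω, N)`. -/
theorem e_mul_R_mul (s : S) (a : Alg k ω N) :
    ∀ r ∈ R k ω N, ∃ r' ∈ R k ω N, e k ω N s * r * a = e k ω N s * r' := by
  obtain ⟨y, rfl⟩ := RingQuot.mkAlgHom_surjective k (Rel k ω N) a
  induction y using FreeAlgebra.induction with
  | grade0 c =>
    intro r hr
    refine ⟨c • r, Subalgebra.smul_mem _ hr c, ?_⟩
    rw [AlgHom.commutes, ← Algebra.commutes, ← Algebra.smul_def, mul_smul_comm]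
  | grade1 g =>
    intro r hr
    cases g with
    | e u => exact e_mul_R_mul_e k ω N s u r hr
    | x => exact ⟨r * x k ω N, mul_mem hr (x_mem_R k ω N), mul_assoc _ _ _⟩
  | mul a b ha hb =>
    intro r hr
    obtain ⟨r', hr', h'⟩ := ha r hr
    obtain ⟨r'', hr'', h''⟩ := hb r' hr'
    exact ⟨r'', hr'', by rw [map_mul, ← mul_assoc, h', h'']⟩
  | add a b ha hb =>
    intro r hr
    obtain ⟨r', hr', h'⟩ := ha r hr
    obtain ⟨r'', hr'', h''⟩ := hb r hr
    exact ⟨r' + r'', add_mem hr' hr'', by rw [map_add, mul_add, h', h'', mul_add]⟩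

/-- The right ideal `N_{s,t} = e_s x^t R = {e_s x^t r | r ∈ R}` of `k(ω, N)`. -/
noncomputable def idealN (s : S) (t : ℕ) : Submodule (Alg k ω N)ᵐᵒᵖ (Alg k ω N) where
  carrier := {a | ∃ r ∈ R k ω N, a = e k ω N s * x k ω N ^ t * r}
  add_mem' := by
    rintro _ _ ⟨r, hr, rfl⟩ ⟨r', hr', rfl⟩
    exact ⟨r + r', add_mem hr hr', by rw [mul_add]⟩
  zero_mem' := ⟨0, zero_mem _, by rw [mul_zero]⟩
  smul_mem' := by
    rintro a _ ⟨r, hr, rfl⟩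
    obtain ⟨r', hr', h⟩ := e_mul_R_mul k ω N ((ω ^ t) s) a.unop r hr
    refine ⟨r', hr', ?_⟩
    rw [← MulOpposite.op_unop a, op_smul_eq_mul, e_mul_x_pow, mul_assoc _ _ r, mul_assoc, h,
      mul_assoc]

end

/-- A module is indecomposable if it is nonzero and is not the (internal) direct sum of two
nonzero submodules. -/
def IsIndecomposable (B : Type*) [Ring B] (M : Type*) [AddCommGroup M] [Module B M] : Prop :=
  Nontrivial M ∧ ∀ P Q : Submodule B M, IsCompl P Q → P = ⊥ ∨ Q = ⊥

end OmegaAlgebra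

/-!
The proof rests on three observations about `A = k(ω, N)`.

* Every element of `R` is zero or has the form `c (1 + r x) x ^ i` with `c ≠ 0` and `i < N`
  (`eq_zero_or_exists_factor`), and `1 + r x` is invertible in `R` because `x` is nilpotent
  (`exists_inverse`). Moreover `e_s A = e_s R` and `A e_u = R e_u`. Together with
  `e_s x ^ (N - 1) ≠ 0`, which is seen in a representation on `S → k[X] / (X ^ N)`, this shows that every nonzero submodule
  of `N_{s,t}` contains `e_s x ^ (N - 1)` (`exists_mul_eq_socle`), so `N_{s,t}` is indecomposable.

* The element `e_{ω ^ t s} x ^ (N - 1 - t)` of `A` does not annihilate `N_{s,t}`, but it annihilates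
  `N_{s',t'}` whenever `t ≤ t'` and `(s, t) ≠ (s', t')`. Hence the `N_{s,t}` are pairwise
  non-isomorphic.

* Let `M` be an indecomposable right ideal and `t` maximal with `M ⊆ x ^ t A`. Some `m e_u` with
  `m ∈ M` lies outside `x ^ (t + 1) A`, and by the first point it is `c g e_s x ^ t` with
  `g = 1 + r x` and `c ≠ 0`. So `M' = g⁻¹ M` contains `N_{s,t} = e_s x ^ t A`, while
  `M' ⊆ x ^ t A` gives `e_s M' ⊆ N_{s,t} ⊆ M'`. Left multiplication by the idempotent `e_s` is therefore
  a projection of `M'` onto `N_{s,t}`, and indecomposability forces `M' = N_{s,t}`, that is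
  `M = g N_{s,t}` (`eq_smul_idealN_of_isIndecomposable`).
-/

open scoped Pointwise

namespace OmegaAlgebra

universe u v

section

variable (k : Type u) [Field k] {S : Type v} [Fintype S] (ω : Equiv.Perm S) (N : ℕ)

/-! ### The relations and the subalgebra generated by `x` -/

theorem x_pow_N : x k ω N ^ N = 0 := by
  simpa [x] using RingQuot.mkAlgHom_rel k (Rel.pow (k := k) (ω := ω) (N := N))

theorem sum_e : ∑ s : S, e k ω N s = 1 := by
  simpa [e] using (RingQuot.mkAlgHom_rel k (Rel.one (k := k) (ω := ω) (N := N))).symm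

theorem x_pow_eq_zero {n : ℕ} (h : N ≤ n) : x k ω N ^ n = 0 :=
  pow_eq_zero_of_le h (x_pow_N k ω N)

variable {k ω N} in
theorem mul_comm_of_mem_R {a b : Alg k ω N} (ha : a ∈ R k ω N) (hb : b ∈ R k ω N) :
    a * b = b * a := by
  rw [R, Algebra.adjoin_singleton_eq_range_aeval] at ha hb
  obtain ⟨p, rfl⟩ := ha
  obtain ⟨q, rfl⟩ := hb
  exact (Polynomial.aeval_mul _).symm.trans ((congrArg _ (mul_comm p q)).trans
    (Polynomial.aeval_mul _))

theorem x_pow_mem_R (n : ℕ) : x k ω N ^ n ∈ R k ω N := pow_mem (x_mem_R k ω N) n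

variable {k ω N} in
theorem one_add_mul_x_mem_R {r : Alg k ω N} (hr : r ∈ R k ω N) : 1 + r * x k ω N ∈ R k ω N :=
  add_mem (one_mem _) (mul_mem hr (x_mem_R k ω N))

variable {k ω N} in
/-- `R` is a quotient of `k[X] / (X ^ N)`: split off from a polynomial the largest power of `X`. -/
theorem eq_zero_or_exists_factor {r : Alg k ω N} (hr : r ∈ R k ω N) :
    r = 0 ∨ ∃ i < N, ∃ c : k, c ≠ 0 ∧ ∃ r' ∈ R k ω N,
      r = c • ((1 + r' * x k ω N) * x k ω N ^ i) := by
  rw [R, Algebra.adjoin_singleton_eq_range_aeval] at hr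
  obtain ⟨p, rfl⟩ := hr
  change Polynomial.aeval (x k ω N) p = 0 ∨ _
  by_cases hp : p = 0
  · left; simp [hp]
  obtain ⟨q, hq, hq'⟩ := Polynomial.exists_eq_pow_rootMultiplicity_mul_and_not_dvd p hp 0
  set i := p.rootMultiplicity 0
  rw [map_zero, sub_zero] at hq hq'
  have hc : q.coeff 0 ≠ 0 := fun h => hq' (Polynomial.X_dvd_iff.2 h)
  have hx : Polynomial.aeval (x k ω N) p
      = x k ω N ^ i * Polynomial.aeval (x k ω N) q := by
    conv_lhs => rw [hq]
    simp
  rcases le_or_gt N i with hi | hi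
  · left; rw [hx, x_pow_eq_zero k ω N hi, zero_mul]
  · right
    have hmem : ∀ f : Polynomial k, Polynomial.aeval (x k ω N) f ∈ R k ω N := fun f =>
      Polynomial.aeval_mem_adjoin_singleton k _
    refine ⟨i, hi, q.coeff 0, hc, (q.coeff 0)⁻¹ • Polynomial.aeval (x k ω N) q.divX,
      Subalgebra.smul_mem _ (hmem _) _, ?_⟩
    change Polynomial.aeval (x k ω N) p = _
    rw [hx, mul_comm_of_mem_R (x_pow_mem_R k ω N i) (hmem q), ← smul_mul_assoc]
    congr 1
    conv_lhs => rw [← Polynomial.divX_mul_X_add q]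
    rw [smul_add, smul_mul_assoc, smul_smul, mul_inv_cancel₀ hc, one_smul, map_add, map_mul,
      Polynomial.aeval_X, Polynomial.aeval_C, Algebra.algebraMap_eq_smul_one, add_comm]

variable {k ω N} in
theorem exists_inverse {r : Alg k ω N} (hr : r ∈ R k ω N) :
    ∃ g ∈ R k ω N, (1 + r * x k ω N) * g = 1 ∧ g * (1 + r * x k ω N) = 1 := by
  have hpow : (-r * x k ω N) ^ N = 0 := by
    have hcomm : Commute (-r) (x k ω N) := mul_comm_of_mem_R (neg_mem hr) (x_mem_R k ω N)
    rw [hcomm.mul_pow, x_pow_N, mul_zero]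
  have hneg : 1 + r * x k ω N = 1 - -r * x k ω N :=
    (sub_neg_eq_add 1 _).symm.trans (congrArg (1 - ·) (neg_mul r (x k ω N)).symm)
  refine ⟨∑ i ∈ Finset.range N, (-r * x k ω N) ^ i,
    sum_mem fun i _ => pow_mem (mul_mem (neg_mem hr) (x_mem_R k ω N)) i, ?_, ?_⟩
  · rw [hneg, mul_neg_geom_sum, hpow, sub_zero]
  · rw [hneg, geom_sum_mul_neg, hpow, sub_zero]

/-- `A e_u = R e_u`, in a form suited to induction over `A`. -/
theorem mul_R_mul_e (u : S) (a : Alg k ω N) :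
    ∀ r ∈ R k ω N, ∃ r' ∈ R k ω N, a * r * e k ω N u = r' * e k ω N u := by
  obtain ⟨y, rfl⟩ := RingQuot.mkAlgHom_surjective k (Rel k ω N) a
  induction y using FreeAlgebra.induction with
  | grade0 c =>
    intro r hr
    refine ⟨c • r, Subalgebra.smul_mem _ hr c, ?_⟩
    rw [AlgHom.commutes, ← Algebra.smul_def]
  | grade1 g =>
    intro r hr
    cases g with
    | e s =>
      change ∃ r' ∈ R k ω N, e k ω N s * r * e k ω N u = r' * e k ω N u
      rw [R, Algebra.adjoin_singleton_eq_range_aeval] at hr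
      obtain ⟨p, rfl⟩ := hr
      induction p using Polynomial.induction_on' with
      | add p q hp hq =>
        obtain ⟨a, ha, ha'⟩ := hp
        obtain ⟨b, hb, hb'⟩ := hq
        refine ⟨a + b, add_mem ha hb, ?_⟩
        rw [add_mul, ← ha', ← hb', ← add_mul, ← mul_add]
        simp
      | monomial n c =>
        by_cases hu : (ω ^ n) s = u
        · refine ⟨c • x k ω N ^ n, Subalgebra.smul_mem _ (x_pow_mem_R k ω N n) c, ?_⟩
          simp [Polynomial.aeval_monomial, ← Algebra.smul_def, e_mul_x_pow, hu, mul_assoc,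
            e_mul_self]
        · refine ⟨0, zero_mem _, ?_⟩
          simp [Polynomial.aeval_monomial, ← Algebra.smul_def, e_mul_x_pow, mul_assoc,
            e_mul_of_ne k ω N hu]
    | x => exact ⟨x k ω N * r, mul_mem (x_mem_R k ω N) hr, rfl⟩
  | mul a b ha hb =>
    intro r hr
    obtain ⟨r', hr', h'⟩ := hb r hr
    obtain ⟨r'', hr'', h''⟩ := ha r' hr'
    exact ⟨r'', hr'', by rw [map_mul, mul_assoc, mul_assoc, ← mul_assoc _ r, h', ← h'', mul_assoc]⟩
  | add a b ha hb =>
    intro r hr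
    obtain ⟨r', hr', h'⟩ := ha r hr
    obtain ⟨r'', hr'', h''⟩ := hb r hr
    exact ⟨r' + r'', add_mem hr' hr'', by rw [map_add, add_mul, add_mul, h', h'', add_mul]⟩

end

/-! ### A representation detecting `e_s x ^ (N - 1)` -/

section

variable (k : Type u) [Field k] {S : Type v} (ω : Equiv.Perm S) (N : ℕ)

open Classical in
/-- The images of the generators in a representation of `k(ω, N)` on the functions from `S` to
`k[X] / (X ^ N)`: `e_s` restricts a function to `{s}`, and `x` sends `f` to `X · (f ∘ ω)`. -/
noncomputable def genAction : Gen S →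
    Module.End k (S → AdjoinRoot ((Polynomial.X : Polynomial k) ^ N))
  | Gen.e s => LinearMap.single k (fun _ => AdjoinRoot ((Polynomial.X : Polynomial k) ^ N)) s ∘ₗ
      LinearMap.proj s
  | Gen.x => LinearMap.mulLeft k (fun _ : S => AdjoinRoot.root ((Polynomial.X : Polynomial k) ^ N))
      ∘ₗ LinearMap.funLeft k _ ω

open Classical in
theorem genAction_e (s : S) (f : S → AdjoinRoot ((Polynomial.X : Polynomial k) ^ N)) (w : S) :
    genAction k ω N (Gen.e s) f w = if w = s then f s else 0 := by
  simp [genAction, Pi.single_apply]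

theorem genAction_x_pow (n : ℕ) (f : S → AdjoinRoot ((Polynomial.X : Polynomial k) ^ N)) :
    ∀ w : S, (genAction k ω N Gen.x ^ n) f w = AdjoinRoot.root _ ^ n * f ((ω ^ n) w) := by
  induction n with
  | zero => simp
  | succ n ih =>
    intro w
    rw [pow_succ', Module.End.mul_apply]
    change AdjoinRoot.root _ * (genAction k ω N Gen.x ^ n) f (ω w) = _
    rw [ih, pow_succ', mul_assoc, pow_succ ω, Equiv.Perm.mul_apply]

end

section

variable (k : Type u) [Field k] {S : Type v} [Fintype S] (ω : Equiv.Perm S) (N : ℕ)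

theorem root_pow_eq_zero_iff (n : ℕ) :
    AdjoinRoot.root ((Polynomial.X : Polynomial k) ^ N) ^ n = 0 ↔ N ≤ n := by
  rw [← AdjoinRoot.mk_X, ← map_pow, AdjoinRoot.mk_eq_zero,
    pow_dvd_pow_iff Polynomial.X_ne_zero Polynomial.not_isUnit_X]

theorem lift_genAction_rel {a b : FreeAlgebra k (Gen S)} (h : Rel k ω N a b) :
    FreeAlgebra.lift k (genAction k ω N) a = FreeAlgebra.lift k (genAction k ω N) b := by
  classical
  have hx : ∀ f w, genAction k ω N Gen.x f w = AdjoinRoot.root _ * f (ω w) := fun f w => by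
    simpa using genAction_x_pow k ω N 1 f w
  refine LinearMap.ext fun f => funext fun w => ?_
  cases h with
  | idem s => simp [genAction_e]
  | orth s t h => simp [genAction_e, h]
  | one => simp [genAction_e, LinearMap.sum_apply, Finset.sum_apply]
  | pow => simp [genAction_x_pow, (root_pow_eq_zero_iff k N N).2 le_rfl]
  | comm s =>
    by_cases hw : w = s
    · simp [genAction_e, hx, hw]
    · simp [genAction_e, hx, hw]

variable {N} in
theorem e_mul_x_pow_ne_zero (s : S) {n : ℕ} (hn : n < N) : e k ω N s * x k ω N ^ n ≠ 0 := by
  intro h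
  have h' := congrArg (RingQuot.liftAlgHom k ⟨FreeAlgebra.lift k (genAction k ω N),
    fun _ _ h => lift_genAction_rel k ω N h⟩) h
  simp only [e, x, map_mul, map_pow, RingQuot.liftAlgHom_mkAlgHom_apply, FreeAlgebra.lift_ι_apply,
    map_zero] at h'
  have h'' := congrFun (LinearMap.congr_fun h' 1) s
  rw [Module.End.mul_apply, genAction_e, if_pos rfl, genAction_x_pow] at h''
  simp only [Pi.one_apply, mul_one, LinearMap.zero_apply, Pi.zero_apply, root_pow_eq_zero_iff]
    at h''
  omega

/-! ### The right ideals `N_{s,t}` -/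

theorem e_mul_x_pow_mul_mem_idealN (s : S) (t : ℕ) (a : Alg k ω N) :
    e k ω N s * x k ω N ^ t * a ∈ idealN k ω N s t :=
  (idealN k ω N s t).smul_mem (MulOpposite.op a) ⟨1, one_mem _, (mul_one _).symm⟩

/-- Every nonzero element of `e_s R` generates a right ideal containing `e_s x ^ (N - 1)`. -/
theorem exists_mul_eq_socle (s : S) {r : Alg k ω N} (hr : r ∈ R k ω N) (h : e k ω N s * r ≠ 0) :
    ∃ z : Alg k ω N, e k ω N s * r * z = e k ω N s * x k ω N ^ (N - 1) := by
  rcases eq_zero_or_exists_factor hr with rfl | ⟨i, hi, c, hc, r', hr', rfl⟩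
  · simp at h
  · obtain ⟨g, hg, hg1, -⟩ := exists_inverse hr'
    have hcomm := mul_comm_of_mem_R (x_pow_mem_R k ω N i) hg
    refine ⟨c⁻¹ • (g * x k ω N ^ (N - 1 - i)), ?_⟩
    rw [mul_assoc, smul_mul_smul_comm, mul_inv_cancel₀ hc, one_smul, mul_assoc _ (_ ^ i),
      ← mul_assoc (_ ^ i), hcomm, mul_assoc g, ← pow_add, ← mul_assoc _ g, hg1, one_mul]
    congr 3
    omega

theorem isIndecomposable_idealN (s : S) {t : ℕ} (ht : t < N) :
    IsIndecomposable (Alg k ω N)ᵐᵒᵖ (idealN k ω N s t) := by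
  have hne := e_mul_x_pow_ne_zero k ω s ht
  constructor
  · refine (Submodule.nontrivial_iff_ne_bot).2 fun h => hne ?_
    have := e_mul_x_pow_mul_mem_idealN k ω N s t 1
    rwa [h, mul_one, Submodule.mem_bot] at this
  · -- both summands would contain the socle generator `e_s x ^ (N - 1)`
    have key : ∀ P : Submodule (Alg k ω N)ᵐᵒᵖ (idealN k ω N s t), P ≠ ⊥ →
        ∃ y ∈ P, (y : Alg k ω N) = e k ω N s * x k ω N ^ (N - 1) := by
      intro P hP
      obtain ⟨⟨_, r, hr, rfl⟩, hyP, hy⟩ := P.ne_bot_iff.1 hP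
      obtain ⟨z, hz⟩ := exists_mul_eq_socle k ω N s (mul_mem (x_pow_mem_R k ω N t) hr)
        (fun h => hy (Subtype.ext (by simpa [mul_assoc] using h)))
      refine ⟨_, P.smul_mem (MulOpposite.op z) hyP, ?_⟩
      rw [← hz, ← mul_assoc]
      rfl
    intro P Q hPQ
    by_contra! hcon
    obtain ⟨y, hy, hy'⟩ := key P hcon.1
    obtain ⟨z, hz, hz'⟩ := key Q hcon.2
    have hyz : y = z := Subtype.ext (hy'.trans hz'.symm)
    have h0 := Submodule.disjoint_def.1 hPQ.disjoint y hy (hyz ▸ hz)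
    rw [h0] at hy'
    exact e_mul_x_pow_ne_zero k ω s (n := N - 1) (by omega) hy'.symm

/-- For `t ≤ t'`, the element `e_{ω ^ t s} x ^ (N - 1 - t)` annihilates `N_{s',t'}` but not
`N_{s,t}`, unless the two pairs of indices coincide. -/
theorem eq_of_linearEquiv_idealN {s s' : S} {t t' : ℕ} (ht : t < N) (htt : t ≤ t')
    (f : idealN k ω N s t ≃ₗ[(Alg k ω N)ᵐᵒᵖ] idealN k ω N s' t') : s = s' ∧ t = t' := by
  by_contra hcon
  set a := e k ω N ((ω ^ t) s) * x k ω N ^ (N - 1 - t) with ha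
  have hN : t + (N - 1 - t) = N - 1 := by omega
  have hea : x k ω N ^ t * a = e k ω N s * x k ω N ^ (N - 1) := by
    rw [ha, ← mul_assoc, ← e_mul_x_pow, mul_assoc, ← pow_add, hN]
  have hkill : ∀ y ∈ idealN k ω N s' t', y * a = 0 := by
    rintro _ ⟨r, hr, rfl⟩
    -- move all powers of `x` to the left of the idempotent in `a`
    have ha' : a = x k ω N ^ (N - 1 - t) * e k ω N ((ω ^ (N - 1)) s) := by
      rw [ha, e_mul_x_pow, ← Equiv.Perm.mul_apply, ← pow_add, add_comm, hN]
    rcases eq_zero_or_exists_factor hr with rfl | ⟨i, hi, c, hc, r', hr', rfl⟩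
    · simp
    have hcomm := mul_comm_of_mem_R (one_add_mul_x_mem_R hr') (x_pow_mem_R k ω N i)
    have hcomm' := mul_comm_of_mem_R (one_add_mul_x_mem_R hr') (x_pow_mem_R k ω N (N - 1 - t))
    have hxx : x k ω N ^ t' * ((1 + r' * x k ω N) * x k ω N ^ i) * x k ω N ^ (N - 1 - t)
        = x k ω N ^ (t' + i + (N - 1 - t)) * (1 + r' * x k ω N) := by
      rw [hcomm, mul_assoc, mul_assoc, hcomm', pow_add, pow_add, mul_assoc, mul_assoc]
    have hxe : e k ω N s' * x k ω N ^ t' * (c • ((1 + r' * x k ω N) * x k ω N ^ i)) * a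
        = c • (e k ω N s' * (x k ω N ^ (t' + i + (N - 1 - t)) * (1 + r' * x k ω N))
          * e k ω N ((ω ^ (N - 1)) s)) := by
      rw [← hxx, ha']
      simp only [mul_smul_comm, smul_mul_assoc, mul_assoc]
    rw [hxe]
    by_cases hlt : N ≤ t' + i + (N - 1 - t)
    · rw [x_pow_eq_zero k ω N hlt]; simp
    · have htt' : t = t' := by omega
      have hs : s ≠ s' := fun h => hcon ⟨h, htt'⟩
      have hexp : t' + i + (N - 1 - t) = N - 1 := by omega
      have hxr : x k ω N ^ (N - 1) * (1 + r' * x k ω N) = x k ω N ^ (N - 1) := by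
        rw [mul_add, mul_comm_of_mem_R hr' (x_mem_R k ω N), ← mul_assoc, ← pow_succ,
          x_pow_eq_zero k ω N (n := N - 1 + 1) (by omega), zero_mul, add_zero, mul_one]
      rw [hexp, hxr, mul_assoc, ← e_mul_x_pow, ← mul_assoc, e_mul_of_ne k ω N hs.symm, zero_mul,
        smul_zero]
  have hmem := e_mul_x_pow_mul_mem_idealN k ω N s t 1
  rw [mul_one] at hmem
  set y : idealN k ω N s t := ⟨_, hmem⟩ with hy
  have h1 : MulOpposite.op a • f y = 0 := Subtype.ext (hkill _ (f y).2)
  rw [← map_smul, LinearEquiv.map_eq_zero_iff] at h1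
  have h2 : e k ω N s * x k ω N ^ t * a = 0 := congrArg Subtype.val h1
  rw [mul_assoc, hea, ← mul_assoc, e_mul_self] at h2
  exact e_mul_x_pow_ne_zero k ω s (n := N - 1) (by omega) h2

/-! ### Indecomposable right ideals -/

variable {k ω N} in
/-- Left multiplication by a left-invertible element identifies a right ideal with its image. -/
noncomputable def equivSMul {g h : Alg k ω N} (hhg : h * g = 1)
    (M : Submodule (Alg k ω N)ᵐᵒᵖ (Alg k ω N)) :
    M ≃ₗ[(Alg k ω N)ᵐᵒᵖ] (g • M : Submodule (Alg k ω N)ᵐᵒᵖ (Alg k ω N)) :=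
  Submodule.equivMapOfInjective (DistribSMul.toLinearMap (Alg k ω N)ᵐᵒᵖ (Alg k ω N) g)
    (fun a b hab => by
      have hab' : g * a = g * b := hab
      rw [← one_mul a, ← one_mul b, ← hhg, mul_assoc, mul_assoc, hab']) M

theorem IsIndecomposable.of_linearEquiv {B M M' : Type*} [Ring B] [AddCommGroup M] [Module B M]
    [AddCommGroup M'] [Module B M'] (f : M ≃ₗ[B] M') (h : IsIndecomposable B M) :
    IsIndecomposable B M' := by
  refine ⟨have := h.1; f.symm.toEquiv.nontrivial, fun P Q hPQ => ?_⟩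
  have := h.2 _ _ ((OrderIso.isCompl_iff (Submodule.orderIsoMapComap f).symm).1 hPQ)
  exact this.imp (fun h => (map_eq_bot_iff (Submodule.orderIsoMapComap f).symm).1 h)
    fun h => (map_eq_bot_iff (Submodule.orderIsoMapComap f).symm).1 h

/-- If `M ⊆ x ^ t A` and `t` is maximal, some `m e_u` with `m ∈ M` is a nonzero scalar times
`(1 + r x) e_s x ^ t`: here `e_s x ^ t = x ^ t e_u`, so that `s = ω ^ (-t) u`. -/
theorem exists_leading_term_mem (M : Submodule (Alg k ω N)ᵐᵒᵖ (Alg k ω N)) (hM : M ≠ ⊥) :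
    ∃ t < N, ∃ s : S, ∃ r ∈ R k ω N, (∀ m ∈ M, ∃ b, m = x k ω N ^ t * b) ∧
      (1 + r * x k ω N) * (e k ω N s * x k ω N ^ t) ∈ M := by
  classical
  have hex : ∃ t, ¬ ∀ m ∈ M, ∃ b, m = x k ω N ^ t * b := by
    refine ⟨N, fun h => hM ((Submodule.eq_bot_iff _).2 fun m hm => ?_)⟩
    obtain ⟨b, rfl⟩ := h m hm
    rw [x_pow_N, zero_mul]
  have hmin : ∀ n, n < Nat.find hex → ∀ m ∈ M, ∃ b, m = x k ω N ^ n * b :=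
    fun n hn => not_not.1 (Nat.find_min hex hn)
  have hspec := Nat.find_spec hex
  obtain ⟨t, ht⟩ : ∃ t, Nat.find hex = t + 1 :=
    Nat.exists_eq_succ_of_ne_zero fun h0 => hspec (by rw [h0]; exact fun m _ => ⟨m, by simp⟩)
  rw [ht] at hspec
  have htM := hmin t (by omega)
  have htN : t < N := by
    refine lt_of_not_ge fun h => hM ((Submodule.eq_bot_iff _).2 fun m hm => ?_)
    obtain ⟨b, rfl⟩ := htM m hm
    rw [x_pow_eq_zero k ω N h, zero_mul]
  push Not at hspec
  obtain ⟨m, hm, hmx⟩ := hspec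
  obtain ⟨u, hu⟩ : ∃ u, ∀ b, m * e k ω N u ≠ x k ω N ^ (t + 1) * b := by
    by_contra! h
    choose b hb using h
    refine hmx (∑ u, b u) ?_
    rw [Finset.mul_sum, ← mul_one m, ← sum_e, Finset.mul_sum]
    exact Finset.sum_congr rfl fun u _ => hb u
  obtain ⟨b, rfl⟩ := htM m hm
  obtain ⟨r, hr, hbr⟩ := mul_R_mul_e k ω N u b 1 (one_mem _)
  rw [mul_one] at hbr
  have hmu : x k ω N ^ t * b * e k ω N u ∈ M := M.smul_mem (MulOpposite.op (e k ω N u)) hm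
  rw [mul_assoc, hbr] at hu hmu
  rcases eq_zero_or_exists_factor hr with rfl | ⟨i, hi, c, hc, r', hr', rfl⟩
  · exact absurd (by simp) (hu 0)
  have hg := one_add_mul_x_mem_R hr'
  rcases i with _ | i
  · refine ⟨t, htN, (ω ^ t).symm u, r', hr', htM, ?_⟩
    have hMc := M.smul_mem (MulOpposite.op (algebraMap k _ c⁻¹)) hmu
    rw [op_smul_eq_mul, ← Algebra.commutes, ← Algebra.smul_def, pow_zero, mul_one, smul_mul_assoc,
      mul_smul_comm, smul_smul, inv_mul_cancel₀ hc, one_smul, ← mul_assoc,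
      mul_comm_of_mem_R (x_pow_mem_R k ω N t) hg, mul_assoc] at hMc
    rwa [e_mul_x_pow, Equiv.apply_symm_apply]
  · refine absurd ?_ (hu (c • (x k ω N ^ i * (1 + r' * x k ω N) * e k ω N u)))
    rw [mul_comm_of_mem_R hg (x_pow_mem_R k ω N _)]
    simp only [mul_smul_comm, smul_mul_assoc, ← mul_assoc, ← pow_add]
    rw [add_assoc, add_comm 1 i]

theorem eq_smul_idealN_of_isIndecomposable (M : Submodule (Alg k ω N)ᵐᵒᵖ (Alg k ω N))
    (hM : IsIndecomposable (Alg k ω N)ᵐᵒᵖ M) :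
    ∃ r ∈ R k ω N, ∃ s : S, ∃ t < N, M = (1 + r * x k ω N) • idealN k ω N s t := by
  obtain ⟨t, ht, s, r, hr, hMt, hmem⟩ := exists_leading_term_mem k ω N M
    ((Submodule.nontrivial_iff_ne_bot).1 hM.1)
  obtain ⟨h, hh, hgh, hhg⟩ := exists_inverse hr
  set g := 1 + r * x k ω N
  refine ⟨r, hr, s, t, ht, ?_⟩
  have hmul : ∀ m ∈ M, ∀ a, m * a ∈ M := fun m hm a => M.smul_mem (MulOpposite.op a) hm
  -- the summand on which the projection `m ↦ g e_s g⁻¹ m` of `M` is the identity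
  let P : Submodule (Alg k ω N)ᵐᵒᵖ M := (g • idealN k ω N s t).comap M.subtype
  let Q : Submodule (Alg k ω N)ᵐᵒᵖ M :=
    (LinearMap.ker (DistribSMul.toLinearMap (Alg k ω N)ᵐᵒᵖ (Alg k ω N) (e k ω N s * h))).comap
      M.subtype
  have hP : ∀ m : M, m ∈ P ↔ ∃ n ∈ idealN k ω N s t, g * n = m := fun m =>
    Submodule.mem_smul_pointwise_iff_exists _ _ _
  have hQ : ∀ m : M, m ∈ Q ↔ e k ω N s * h * m = 0 := fun m => Iff.rfl
  have hle : g • idealN k ω N s t ≤ M := by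
    intro m hm
    obtain ⟨_, ⟨r', -, rfl⟩, rfl⟩ := (Submodule.mem_smul_pointwise_iff_exists _ _ _).1 hm
    have := hmul _ hmem r'
    rwa [mul_assoc] at this
  have hen : ∀ n ∈ idealN k ω N s t, e k ω N s * n = n := by
    rintro _ ⟨r', -, rfl⟩
    rw [← mul_assoc, ← mul_assoc, e_mul_self]
  have hproj : ∀ m ∈ M, e k ω N s * h * m ∈ idealN k ω N s t := by
    intro m hm
    obtain ⟨b, rfl⟩ := hMt m hm
    rw [mul_assoc, ← mul_assoc h, mul_comm_of_mem_R hh (x_pow_mem_R k ω N t), mul_assoc,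
      ← mul_assoc]
    exact e_mul_x_pow_mul_mem_idealN k ω N s t _
  -- `m ↦ g e_s g⁻¹ m` maps `M` into `g N_{s,t}` by `hproj` and has kernel `Q`
  have hcompl : IsCompl P Q := by
    constructor
    · rw [Submodule.disjoint_def]
      intro m hmP hmQ
      obtain ⟨n, hn, hnm⟩ := (hP m).1 hmP
      have h0 := (hQ m).1 hmQ
      rw [← hnm, mul_assoc, ← mul_assoc h, hhg, one_mul, hen n hn] at h0
      exact Subtype.ext (by rw [← hnm, h0, mul_zero]; rfl)
    · rw [codisjoint_iff, Submodule.eq_top_iff']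
      intro m
      have hn := hproj m m.2
      have hgn : g * (e k ω N s * h * m) ∈ M :=
        hle ((Submodule.mem_smul_pointwise_iff_exists _ _ _).2 ⟨_, hn, rfl⟩)
      refine Submodule.mem_sup.2 ⟨⟨_, hgn⟩, (hP _).2 ⟨_, hn, rfl⟩, m - ⟨_, hgn⟩, (hQ _).2 ?_,
        Subtype.ext (add_sub_cancel (g * (e k ω N s * h * m)) (m : Alg k ω N))⟩
      change e k ω N s * h * (m - g * (e k ω N s * h * m)) = 0
      rw [mul_sub, mul_assoc _ h (g * _), ← mul_assoc h g, hhg, one_mul, hen _ hn, sub_self]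
  rcases hM.2 P Q hcompl with hbot | hbot
  · exfalso
    have hm0 := (Submodule.eq_bot_iff _).1 hbot ⟨_, hmem⟩
      ((hP _).2 ⟨_, by simpa using e_mul_x_pow_mul_mem_idealN k ω N s t 1, rfl⟩)
    have hm0' : g * (e k ω N s * x k ω N ^ t) = 0 := congrArg Subtype.val hm0
    refine e_mul_x_pow_ne_zero k ω s ht ?_
    rw [← one_mul (e k ω N s * _), ← hhg, mul_assoc, hm0', mul_zero]
  · have hPtop : P = ⊤ := by simpa [hbot] using hcompl.sup_eq_top
    refine le_antisymm (fun m hm => ?_) hle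
    have : (⟨m, hm⟩ : M) ∈ P := hPtop ▸ Submodule.mem_top
    exact this

end

end OmegaAlgebra

theorem theorem2p1 {k : Type*} [Field k] {S : Type*} [Fintype S] (ω : Equiv.Perm S) (N : ℕ)
    (hN : 1 ≤ N) :
    -- the `N_{s,t}` are indecomposable right ideals
    (∀ s : S, ∀ t < N,
      OmegaAlgebra.IsIndecomposable (OmegaAlgebra.Alg k ω N)ᵐᵒᵖ (OmegaAlgebra.idealN k ω N s t)) ∧
    -- every indecomposable right ideal is isomorphic to some `N_{s,t}`
    (∀ M : Submodule (OmegaAlgebra.Alg k ω N)ᵐᵒᵖ (OmegaAlgebra.Alg k ω N),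
      OmegaAlgebra.IsIndecomposable (OmegaAlgebra.Alg k ω N)ᵐᵒᵖ M →
      ∃ s : S, ∃ t < N,
        Nonempty (M ≃ₗ[(OmegaAlgebra.Alg k ω N)ᵐᵒᵖ] OmegaAlgebra.idealN k ω N s t)) ∧
    -- different pairs of indices give non-isomorphic right ideals
    (∀ s s' : S, ∀ t < N, ∀ t' < N,
      Nonempty (OmegaAlgebra.idealN k ω N s t ≃ₗ[(OmegaAlgebra.Alg k ω N)ᵐᵒᵖ]
        OmegaAlgebra.idealN k ω N s' t') → s = s' ∧ t = t') ∧
    -- the set of all indecomposable right ideals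
    {M : Submodule (OmegaAlgebra.Alg k ω N)ᵐᵒᵖ (OmegaAlgebra.Alg k ω N) |
        OmegaAlgebra.IsIndecomposable (OmegaAlgebra.Alg k ω N)ᵐᵒᵖ M} =
      {M | ∃ r ∈ OmegaAlgebra.R k ω N, ∃ s : S, ∃ t < N,
        M = (1 + r * OmegaAlgebra.x k ω N) • OmegaAlgebra.idealN k ω N s t} := by
  open OmegaAlgebra in
  refine ⟨fun s t ht => isIndecomposable_idealN k ω N s ht, fun M hM => ?_,
    fun s s' t ht t' ht' ⟨f⟩ => ?_, Set.ext fun M => ⟨fun hM => ?_, ?_⟩⟩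
  · obtain ⟨r, hr, s, t, ht, rfl⟩ := eq_smul_idealN_of_isIndecomposable k ω N M hM
    obtain ⟨h, -, -, hhg⟩ := exists_inverse hr
    exact ⟨s, t, ht, ⟨(equivSMul hhg _).symm⟩⟩
  · rcases le_total t t' with h | h
    · exact eq_of_linearEquiv_idealN k ω N ht h f
    · obtain ⟨h1, h2⟩ := eq_of_linearEquiv_idealN k ω N ht' h f.symm
      exact ⟨h1.symm, h2.symm⟩
  · exact eq_smul_idealN_of_isIndecomposable k ω N M hM
  · rintro ⟨r, hr, s, t, ht, rfl⟩
    obtain ⟨h, -, -, hhg⟩ := exists_inverse hr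
    exact IsIndecomposable.of_linearEquiv
      (M' := ((1 + r * OmegaAlgebra.x k ω N) • idealN k ω N s t :
        Submodule (Alg k ω N)ᵐᵒᵖ (Alg k ω N)))
      (equivSMul hhg (idealN k ω N s t)) (isIndecomposable_idealN k ω N s ht)
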